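/- Let $G$ be an uncountable Polish group and let $P(G)$ be the space of Borel probability measures on $G$, equipped with the weak (weak*) topology, i.e. the topology of convergence against bounded continuous functions. For a universally measurable set $A\subseteq G$ (one that is measurable with respect to the completion of every Borel probability measure on $G$; every analytic set is universally measurable) let $$T_l(A)=\{\mu\in P(G):\ \mu(gA)=0\ \text{ for all } g\in G\}.$$ The set $A$ is called left Haar-null if $T_l(A)\neq\varnothing$, and generically left Haar-null if $T_l(A)$ is co-meager in $P(G)$. Let $A\subseteq G$ be analytic. If $A$ is not generically left Haar-null, then the identity $1$ of $G$ lies in the interior of $$A^{-1}AA^{-1}A=\{a^{-1}bc^{-1}d:\ a,b,c,d\in A\}.$$ In particular, if $A$ is not left Haar-null, then $A$ is not generically left Haar-null, and hence $1\in\operatorname{int}(A^{-1}AA^{-1}A)$. -/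

import Mathlib

open scoped Pointwise

namespace SteinhausPolish

open MeasureTheory

/-- A subset of a topological space (with its Borel σ-algebra) is universally measurable if it is
measurable with respect to the completion of every Borel probability measure. -/
def UniversallyMeasurable {X : Type*} [MeasurableSpace X] (A : Set X) : Prop :=
  ∀ μ : ProbabilityMeasure X, NullMeasurableSet A (μ : Measure X)

/-- `T_l(A)`: the Borel probability measures on `G` vanishing on all left translates of `A`. -/
def leftNullMeasures {G : Type*} [Group G] [MeasurableSpace G] (A : Set G) :
    Set (ProbabilityMeasure G) :=
  {μ | ∀ g : G, (μ : Measure G) (g • A) = 0}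

/-- `A` is left Haar-null: it is universally measurable and `T_l(A)` is not empty. -/
def IsLeftHaarNull {G : Type*} [Group G] [MeasurableSpace G] (A : Set G) : Prop :=
  UniversallyMeasurable A ∧ ∃ μ : ProbabilityMeasure G, μ ∈ leftNullMeasures A

/-- `A` is generically left Haar-null: it is universally measurable and `T_l(A)` is co-meager in
the space of Borel probability measures on `G` with the topology of weak convergence. -/
def IsGenericallyLeftHaarNull {G : Type*} [Group G] [TopologicalSpace G] [MeasurableSpace G]
    [OpensMeasurableSpace G] (A : Set G) : Prop :=
  UniversallyMeasurable A ∧ leftNullMeasures A ∈ residual (ProbabilityMeasure G)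

end SteinhausPolish

/-!
If `A⁻¹ * A` is non-meagre then, being analytic, it has the Baire property, and Pettis' theorem
puts `1` in the interior of `(A⁻¹ * A)⁻¹ * (A⁻¹ * A)`.

If `A⁻¹ * A` is meagre, then so is its preimage under `(x, y) ↦ x⁻¹ * y`, a left-invariant set
containing `(g • A) ×ˢ (g • A)` for every `g`. Each closed nowhere dense `D ⊆ G × G` is
`(μ × μ)`-null for comeagre many `μ`: the measures with finite support and small atoms are dense,
and their support can be moved so that no two distinct points of it form a pair in `D`. Hence, for
comeagre many `μ`, all the squares `μ (g • A) ^ 2` vanish.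
-/

open Set Filter Topology MeasureTheory Metric
open scoped ENNReal

namespace SteinhausPolish

section AnalyticSets

open PiNat

theorem exists_forall_res_of_forall_exists_cons {α : Type*} {P : List α → Prop} (nil : P [])
    (cons : ∀ s, P s → ∃ a, P (a :: s)) : ∃ x : ℕ → α, ∀ k, P (res x k) := by
  have : Nonempty α := ⟨(cons [] nil).choose⟩
  choose! next hnext using cons
  let branch (k : ℕ) : List α := Nat.rec [] (fun _ s => next s :: s) k
  have hres (k : ℕ) : res (fun i => next (branch i)) k = branch k := by
    induction k with
    | zero => rfl
    | succ k ih => rw [res_succ, ih]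
  refine ⟨fun i => next (branch i), fun k => ?_⟩
  rw [hres]
  induction k with
  | zero => exact nil
  | succ k ih => exact hnext _ ih

/-- The image under `f` of the cylinder of sequences with initial segment `s`. As in `PiNat.res`,
initial segments are listed in reverse order, so that `a :: s` extends `s`. -/
def cylinderImage {α X : Type*} (f : (ℕ → α) → X) (s : List α) : Set X :=
  f '' {x | res x s.length = s}

theorem cylinderImage_nil {α X : Type*} (f : (ℕ → α) → X) : cylinderImage f [] = range f := by
  simp [cylinderImage]

theorem cylinderImage_res {α X : Type*} (f : (ℕ → α) → X) (x : ℕ → α) (k : ℕ) :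
    cylinderImage f (res x k) = f '' cylinder x k := by
  simp [cylinderImage, cylinder_eq_res]

theorem cylinderImage_subset_iUnion_cons {α X : Type*} (f : (ℕ → α) → X) (s : List α) :
    cylinderImage f s ⊆ ⋃ a, cylinderImage f (a :: s) := by
  rintro _ ⟨x, hx, rfl⟩
  exact mem_iUnion.2 ⟨x s.length, x, by simpa using hx, rfl⟩

theorem eq_of_forall_mem_closure_image_cylinder {E : ℕ → Type*} [∀ n, TopologicalSpace (E n)]
    [∀ n, DiscreteTopology (E n)] {X : Type*} [TopologicalSpace X] [T2Space X]
    {f : (∀ n, E n) → X} {x : ∀ n, E n} (hf : ContinuousAt f x) {y : X}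
    (hy : ∀ n, y ∈ closure (f '' cylinder x n)) : f x = y := by
  have hcluster : ClusterPt y (map f (𝓝 x)) := by
    refine clusterPt_iff_forall_mem_closure.2 fun s hs => ?_
    obtain ⟨_, ⟨z, n, rfl⟩, hxz, hzs⟩ := (isTopologicalBasis_cylinders E).mem_nhds_iff.1 hs
    rw [← mem_cylinder_iff_eq.1 hxz] at hzs
    exact closure_mono (image_subset_iff.2 hzs) (hy n)
  have : (𝓝 y ⊓ 𝓝 (f x)).NeBot := hcluster.mono hf
  exact (eq_of_nhds_neBot this).symm

/-- `M` is a measurable hull of `B` modulo the filter `l`: a measurable superset of `B` which is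
least, modulo `l`, among all measurable supersets. -/
structure IsMeasurableHull {X : Type*} [MeasurableSpace X] (l : Filter X) (B M : Set X) :
    Prop where
  measurableSet : MeasurableSet M
  subset : B ⊆ M
  eventuallyLE : ∀ N, MeasurableSet N → B ⊆ N → M ≤ᶠ[l] N

/-- Modulo `l`, a point of the hull of a cylinder image lies in the hull of the image of some longer
cylinder, so descending along longer and longer cylinders produces a preimage of it. -/
theorem eventuallyMeasurableSet_of_analyticSet {X : Type*} [TopologicalSpace X] [T2Space X]
    [m : MeasurableSpace X] [OpensMeasurableSpace X] {l : Filter X} [CountableInterFilter l]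
    (hull : ∀ B : Set X, ∃ M, IsMeasurableHull l B M) {A : Set X} (hA : AnalyticSet A) :
    EventuallyMeasurableSet m l A := by
  rw [AnalyticSet] at hA
  obtain rfl | ⟨f, hf, rfl⟩ := hA
  · exact MeasurableSet.empty.eventuallyMeasurableSet
  choose M hM using hull
  let H (s : List ℕ) : Set X := M (cylinderImage f s) ∩ closure (cylinderImage f s)
  have measurableSet_H (s) : MeasurableSet (H s) :=
    (hM _).measurableSet.inter isClosed_closure.measurableSet
  have subset_H (s) : cylinderImage f s ⊆ H s := subset_inter (hM _).subset subset_closure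
  have exists_cons : ∀ᶠ y in l, ∀ s, y ∈ H s → ∃ n, y ∈ H (n :: s) := by
    refine eventually_countable_forall.2 fun s => ?_
    have hle := (hM (cylinderImage f s)).eventuallyLE (⋃ n, H (n :: s))
      (.iUnion fun n => measurableSet_H _)
      ((cylinderImage_subset_iUnion_cons f s).trans (iUnion_mono fun n => subset_H _))
    filter_upwards [hle] with y hy hys
    exact mem_iUnion.1 (hy hys.1)
  refine (measurableSet_H []).eventuallyMeasurableSet.congr ?_
  filter_upwards [exists_cons] with y hy
  refine propext ⟨fun h => subset_H [] (by rwa [cylinderImage_nil]), fun h => ?_⟩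
  obtain ⟨x, hx⟩ := exists_forall_res_of_forall_exists_cons (P := fun s => y ∈ H s) h hy
  exact ⟨x, eq_of_forall_mem_closure_image_cylinder hf.continuousAt fun k =>
    cylinderImage_res f x k ▸ (hx k).2⟩

theorem isMeasurableHull_toMeasurable {X : Type*} [MeasurableSpace X] (μ : Measure X) [SFinite μ]
    (B : Set X) : IsMeasurableHull (ae μ) B (toMeasurable μ B) where
  measurableSet := measurableSet_toMeasurable μ B
  subset := subset_toMeasurable μ B
  eventuallyLE N hN hBN := by
    rw [ae_le_set, sdiff_eq, Measure.measure_toMeasurable_inter_of_sFinite hN.compl,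
      ← sdiff_eq, sdiff_eq_empty.2 hBN, measure_empty]

theorem nullMeasurableSet_of_analyticSet {X : Type*} [TopologicalSpace X] [T2Space X]
    [MeasurableSpace X] [OpensMeasurableSpace X] {A : Set X} (hA : AnalyticSet A) (μ : Measure X)
    [SFinite μ] : NullMeasurableSet A μ :=
  eventuallyMeasurableSet_of_analyticSet
    (fun B => ⟨_, isMeasurableHull_toMeasurable μ B⟩) hA

theorem exists_isMeasurableHull_residual {X : Type*} [TopologicalSpace X]
    [SecondCountableTopology X] [MeasurableSpace X] [BorelSpace X] (B : Set X) :
    ∃ M, IsMeasurableHull (residual X) B M := by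
  let b := TopologicalSpace.countableBasis X
  let O : Set X := ⋃ U ∈ {U ∈ b | IsMeagre (U ∩ B)}, U
  have isOpen_O : IsOpen O := isOpen_biUnion fun U hU =>
    TopologicalSpace.isOpen_of_mem_countableBasis hU.1
  have isMeagre_O_inter : IsMeagre (O ∩ B) := by
    simp only [O, iUnion_inter]
    exact isMeagre_biUnion ((TopologicalSpace.countable_countableBasis X).mono fun U hU => hU.1)
      fun U hU => hU.2
  obtain ⟨S, S_open, S_dense, S_countable, hS⟩ := mem_residual_iff.1 isMeagre_O_inter
  have sInter_mem_residual : ⋂₀ S ∈ residual X :=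
    mem_residual_iff.2 ⟨S, S_open, S_dense, S_countable, Subset.rfl⟩
  refine ⟨(O ∩ ⋂₀ S)ᶜ, ?_, fun x hxB hx => hS hx.2 ⟨hx.1, hxB⟩, fun N hN hBN => ?_⟩
  · exact (isOpen_O.measurableSet.inter
      (.sInter S_countable fun U hU => (S_open U hU).measurableSet)).compl
  obtain ⟨W, hW, hNW⟩ := hN.compl.residualEq_isOpen
  have W_subset_O : W ⊆ O := by
    intro x hx
    obtain ⟨U, hU, hxU, hUW⟩ :=
      (TopologicalSpace.isBasis_countableBasis X).exists_subset_of_mem_open hx hW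
    have isMeagre_U_inter : ∀ᶠ y in residual X, y ∈ (U ∩ B)ᶜ := by
      filter_upwards [hNW] with y hy hyUB
      exact hy.mpr (hUW hyUB.1) (hBN hyUB.2)
    exact mem_biUnion ⟨hU, isMeagre_U_inter⟩ hxU
  filter_upwards [hNW, sInter_mem_residual] with x hx hxS hxM
  by_contra hxN
  exact hxM ⟨W_subset_O (hx.mp hxN), hxS⟩

theorem baireMeasurableSet_of_analyticSet {X : Type*} [TopologicalSpace X] [T2Space X]
    [SecondCountableTopology X] {A : Set X} (hA : AnalyticSet A) : BaireMeasurableSet A := by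
  borelize X
  obtain ⟨B, hB, hAB⟩ := eventuallyMeasurableSet_of_analyticSet
    (l := residual X) exists_isMeasurableHull_residual hA
  exact hB.baireMeasurableSet.congr hAB.symm

theorem analyticSet_prod {X Y : Type*} [TopologicalSpace X] [TopologicalSpace Y] {A : Set X}
    {B : Set Y} (hA : AnalyticSet A) (hB : AnalyticSet B) : AnalyticSet (A ×ˢ B) := by
  obtain ⟨α, _, _, f, hf, rfl⟩ := analyticSet_iff_exists_polishSpace_range.1 hA
  obtain ⟨β, _, _, g, hg, rfl⟩ := analyticSet_iff_exists_polishSpace_range.1 hB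
  rw [← range_prodMap]
  exact analyticSet_range_of_polishSpace (hf.prodMap hg)

theorem analyticSet_mul {M : Type*} [Mul M] [TopologicalSpace M] [ContinuousMul M] {A B : Set M}
    (hA : AnalyticSet A) (hB : AnalyticSet B) : AnalyticSet (A * B) := by
  rw [← image_mul_prod]
  exact (analyticSet_prod hA hB).image_of_continuous continuous_mul

theorem analyticSet_inv {G : Type*} [InvolutiveInv G] [TopologicalSpace G] [ContinuousInv G]
    {A : Set G} (hA : AnalyticSet A) : AnalyticSet A⁻¹ := by
  rw [← image_inv_eq_inv]
  exact hA.image_of_continuous continuous_inv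

end AnalyticSets

/-- **Pettis' theorem**. -/
theorem one_mem_interior_inv_mul_of_not_isMeagre {G : Type*} [Group G] [TopologicalSpace G]
    [SeparatelyContinuousMul G] [BaireSpace G] {B : Set G} (hB : BaireMeasurableSet B)
    (hB' : ¬ IsMeagre B) : (1 : G) ∈ interior (B⁻¹ * B) := by
  obtain ⟨U, hU, hBU⟩ := hB.residualEq_isOpen
  obtain ⟨u, hu⟩ : U.Nonempty := by
    by_contra! rfl
    exact hB' (eventuallyEq_empty.1 hBU)
  have hnhds : (u * ·) ⁻¹' U ∈ 𝓝 (1 : G) :=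
    (hU.preimage (continuous_const_mul u)).mem_nhds (by simpa using hu)
  refine mem_interior_iff_mem_nhds.2 (mem_of_superset hnhds fun g hg => ?_)
  have inter_not_isMeagre : ¬ IsMeagre (U ∩ (· * g) ⁻¹' U) :=
    not_isMeagre_of_isOpen (hU.inter (hU.preimage (continuous_mul_const g))) ⟨u, hu, hg⟩
  have hBUg : ((· * g) ⁻¹' B : Set G) =ᶠ[residual G] ((· * g) ⁻¹' U : Set G) :=
    hBU.comp_tendsto
      (tendsto_residual_of_isOpenMap (continuous_mul_const g) (isOpenMap_mul_right g))
  obtain ⟨x, hxB, hxgB⟩ : (B ∩ (· * g) ⁻¹' B).Nonempty := by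
    by_contra! hempty
    exact inter_not_isMeagre (eventuallyEq_empty.1 (hempty ▸ (hBU.inter hBUg).symm))
  exact ⟨x⁻¹, inv_mem_inv.2 hxB, x * g, hxgB, inv_mul_cancel_left x g⟩

section BaireSpace

theorem isCompact_iInter_cthickening {X : Type*} [PseudoMetricSpace X] [CompleteSpace X]
    {K : ℕ → Set X} (hK : ∀ n, IsCompact (K n)) {δ : ℕ → ℝ} (hδ : Tendsto δ atTop (𝓝 0)) :
    IsCompact (⋂ n, cthickening (δ n) (K n)) := by
  refine TotallyBounded.isCompact_of_isClosed (totallyBounded_iff.2 fun ε hε => ?_)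
    (isClosed_iInter fun n => isClosed_cthickening)
  obtain ⟨n, hn⟩ := (hδ.eventually_lt_const (half_pos hε)).exists
  obtain ⟨t, ht, hKt⟩ := totallyBounded_iff.1 (hK n).totallyBounded (ε / 2) (half_pos hε)
  refine ⟨t, ht, fun x hx => ?_⟩
  obtain ⟨z, hz, hxz⟩ := mem_thickening_iff.1
    (cthickening_subset_thickening' (half_pos hε) hn (K n) (mem_iInter.1 hx n))
  obtain ⟨y, hy, hzy⟩ := mem_iUnion₂.1 (hKt hz)
  refine mem_iUnion₂.2 ⟨y, hy, mem_ball.2 ?_⟩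
  linarith [dist_triangle x z y, mem_ball.1 hzy]

theorem isTightMeasureSet_of_forall_exists_cthickening {X : Type*} [PseudoMetricSpace X]
    [CompleteSpace X] [MeasurableSpace X] {S : Set (Measure X)}
    (h : ∀ δ : ℝ, 0 < δ → ∀ ε : ℝ≥0∞, 0 < ε →
      ∃ K : Set X, IsCompact K ∧ ∀ μ ∈ S, μ (cthickening δ K)ᶜ ≤ ε) :
    IsTightMeasureSet S := by
  rw [isTightMeasureSet_iff_exists_isCompact_measure_compl_le]
  intro ε hε
  obtain ⟨e, he, hesum⟩ := ENNReal.exists_pos_sum_of_countable' hε.ne' ℕ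
  choose K hK hKS using fun n : ℕ => h (1 / (n + 1 : ℝ)) Nat.one_div_pos_of_nat (e n) (he n)
  refine ⟨_, isCompact_iInter_cthickening hK tendsto_one_div_add_atTop_nhds_zero_nat,
    fun μ hμ => ?_⟩
  rw [compl_iInter]
  calc μ (⋃ n : ℕ, (cthickening (1 / (n + 1 : ℝ)) (K n))ᶜ)
      ≤ ∑' n : ℕ, μ (cthickening (1 / (n + 1 : ℝ)) (K n))ᶜ := measure_iUnion_le _
    _ ≤ ∑' n, e n := ENNReal.tsum_le_tsum fun n => hKS n μ hμ
    _ ≤ ε := hesum.le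

theorem measure_compl_thickening_le_of_levyProkhorovEDist_lt {X : Type*} [MeasurableSpace X]
    [PseudoEMetricSpace X] [OpensMeasurableSpace X] {μ ν : Measure X} {r : ℝ≥0∞}
    (h : levyProkhorovEDist μ ν < r) (K : Set X) :
    μ (thickening r.toReal K)ᶜ ≤ ν Kᶜ + r := by
  have hsub : thickening r.toReal (thickening r.toReal K)ᶜ ⊆ Kᶜ := by
    intro x hx hxK
    obtain ⟨y, hy, hxy⟩ := (mem_thickening_iff_exists_edist_lt _ _).1 hx
    exact hy ((mem_thickening_iff_exists_edist_lt _ _).2 ⟨x, hxK, by rwa [edist_comm]⟩)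
  exact (left_measure_le_of_levyProkhorovEDist_lt h isOpen_thickening.measurableSet.compl).trans
    (by gcongr)

theorem isTightMeasureSet_of_totallyBounded {X : Type*} [PseudoMetricSpace X] [CompleteSpace X]
    [SecondCountableTopology X] [MeasurableSpace X] [OpensMeasurableSpace X]
    {S : Set (LevyProkhorov (ProbabilityMeasure X))} (hS : TotallyBounded S) :
    IsTightMeasureSet {(μ.toMeasure : Measure X) | μ ∈ S} := by
  refine isTightMeasureSet_of_forall_exists_cthickening fun δ hδ ε hε => ?_
  obtain ⟨r, hr, hrδ, hrε⟩ : ∃ r > 0, r ≤ ENNReal.ofReal δ ∧ r ≤ ε / 2 :=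
    ⟨min (ENNReal.ofReal δ) (ε / 2), lt_min (by simpa) (ENNReal.half_pos hε.ne'),
      min_le_left _ _, min_le_right _ _⟩
  obtain ⟨F, hF, hSF⟩ := EMetric.totallyBounded_iff.1 hS r hr
  obtain ⟨K, hK, hFK⟩ := isTightMeasureSet_iff_exists_isCompact_measure_compl_le.1
    (isTightMeasureSet_of_isCompact_closure
      (hF.image LevyProkhorov.toMeasure).isCompact.closure) (ε / 2) (ENNReal.half_pos hε.ne')
  refine ⟨K, hK, ?_⟩
  rintro _ ⟨μ, hμ, rfl⟩
  obtain ⟨ν, hν, hμν⟩ := mem_iUnion₂.1 (hSF hμ)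
  have hrδ' : r.toReal ≤ δ := ENNReal.toReal_le_of_le_ofReal hδ.le hrδ
  calc (μ.toMeasure : Measure X) (cthickening δ K)ᶜ
      ≤ (μ.toMeasure : Measure X) (thickening r.toReal K)ᶜ := by
        gcongr
        exact (thickening_mono hrδ' K).trans (thickening_subset_cthickening δ K)
    _ ≤ (ν.toMeasure : Measure X) Kᶜ + r :=
        measure_compl_thickening_le_of_levyProkhorovEDist_lt hμν K
    _ ≤ ε / 2 + ε / 2 := by
        gcongr
        exact hFK _ ⟨_, mem_image_of_mem _ hν, rfl⟩
    _ = ε := ENNReal.add_halves ε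

instance instCompleteSpaceLevyProkhorov {X : Type*} [MetricSpace X] [CompleteSpace X]
    [SecondCountableTopology X] [MeasurableSpace X] [BorelSpace X] :
    CompleteSpace (LevyProkhorov (ProbabilityMeasure X)) := by
  refine Metric.complete_of_cauchySeq_tendsto fun u hu => ?_
  have htight : IsTightMeasureSet
      {(μ : Measure X) | μ ∈ LevyProkhorov.toMeasure '' range u} := by
    convert isTightMeasureSet_of_totallyBounded hu.totallyBounded_range using 1
    simp
  have hcompact := (isCompact_closure_of_isTightMeasureSet htight).image
    LevyProkhorov.continuous_ofMeasure_probabilityMeasure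
  obtain ⟨μ, -, hμ⟩ := cauchySeq_tendsto_of_isComplete hcompact.isComplete
    (fun n => ⟨_, subset_closure (mem_image_of_mem _ (mem_range_self n)), rfl⟩) hu
  exact ⟨μ, hμ⟩

instance instBaireSpaceProbabilityMeasure {X : Type*} [TopologicalSpace X] [PolishSpace X]
    [MeasurableSpace X] [BorelSpace X] : BaireSpace (ProbabilityMeasure X) := by
  let := TopologicalSpace.upgradeIsCompletelyMetrizable X
  exact (LevyProkhorov.probabilityMeasureHomeomorph (Ω := X)).symm.baireSpace

end BaireSpace

section SquareNull

theorem isOpenMap_eval_pair {ι X : Type*} [TopologicalSpace X] {p q : ι} (hpq : p ≠ q) :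
    IsOpenMap fun x : ι → X => (x p, x q) := by
  classical
  refine IsOpenMap.of_sections fun x =>
    ⟨fun y => Function.update (Function.update x p y.1) q y.2, ?_, ?_, fun y => ?_⟩
  · exact ((continuous_const.update p continuous_fst).update q continuous_snd).continuousAt
  · simp
  · simp [Function.update_of_ne hpq]

theorem dense_setOf_pairwise_notMem {ι X : Type*} [Finite ι] [TopologicalSpace X]
    {D : Set (X × X)} (hD : IsClosed D) (hD' : Dense Dᶜ) :
    Dense {x : ι → X | Pairwise fun p q => (x p, x q) ∉ D} := by
  let V (r : {r : ι × ι // r.1 ≠ r.2}) : Set (ι → X) := (fun x => (x r.1.1, x r.1.2)) ⁻¹' Dᶜ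
  have hset : {x : ι → X | Pairwise fun p q => (x p, x q) ∉ D} = ⋂₀ range V := by
    ext x
    simp [V, Pairwise]
  rw [hset]
  refine (finite_range V).dense_sInter ?_ ?_
  · rintro _ ⟨r, rfl⟩
    exact hD.isOpen_compl.preimage (by fun_prop)
  · rintro _ ⟨r, rfl⟩
    exact hD'.preimage (isOpenMap_eval_pair r.2)

theorem prod_map_map_le {Ω X : Type*} [MeasurableSpace Ω] [MeasurableSpace X] (ν : Measure Ω)
    [IsProbabilityMeasure ν] {c : ℝ≥0∞} (hν : ∀ p, ν {p} ≤ c) {x : Ω → X} (hx : Measurable x)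
    {D : Set (X × X)} (hD : MeasurableSet D) (hxD : Pairwise fun p q => (x p, x q) ∉ D) :
    (ν.map x).prod (ν.map x) D ≤ c := by
  have hsection (p : Ω) : Prod.mk p ⁻¹' (Prod.map x x ⁻¹' D) ⊆ {p} := fun q hq =>
    by_contra fun hqp => hxD (Ne.symm hqp) hq
  rw [Measure.map_prod_map _ _ hx hx, Measure.map_apply (hx.prodMap hx) hD,
    Measure.prod_apply (hx.prodMap hx hD)]
  calc ∫⁻ p, ν (Prod.mk p ⁻¹' (Prod.map x x ⁻¹' D)) ∂ν
      ≤ ∫⁻ _, c ∂ν := lintegral_mono fun p => (measure_mono (hsection p)).trans (hν p)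
    _ = c := by simp

theorem tendsto_map_of_ae_tendsto {Ω X ι : Type*} [MeasurableSpace Ω] [TopologicalSpace X]
    [MeasurableSpace X] [OpensMeasurableSpace X] (μ : ProbabilityMeasure Ω) {l : Filter ι}
    [l.IsCountablyGenerated] {F : ι → Ω → X} (hF : ∀ i, AEMeasurable (F i) μ) {f : Ω → X}
    (hf : AEMeasurable f μ) (hlim : ∀ᵐ ω ∂(μ : Measure Ω), Tendsto (F · ω) l (𝓝 (f ω))) :
    Tendsto (fun i => μ.map (hF i)) l (𝓝 (μ.map hf)) := by
  refine ProbabilityMeasure.tendsto_iff_forall_integral_tendsto.2 fun g => ?_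
  have integral_map_eq {h : Ω → X} (hh : AEMeasurable h μ) :
      ∫ x, g x ∂(μ.map hh : Measure X) = ∫ ω, g (h ω) ∂(μ : Measure Ω) :=
    integral_map hh g.continuous.measurable.aestronglyMeasurable
  simp only [integral_map_eq]
  refine tendsto_integral_filter_of_dominated_convergence (fun _ => ‖g‖)
    (.of_forall fun i => (g.continuous.measurable.comp_aemeasurable (hF i)).aestronglyMeasurable)
    (.of_forall fun i => .of_forall fun ω => g.norm_coe_le_norm _) (integrable_const _) ?_
  filter_upwards [hlim] with ω hω
  exact (g.continuous.tendsto _).comp hω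

theorem continuous_map_of_finite {ι X : Type*} [Finite ι] [MeasurableSpace ι]
    [DiscreteMeasurableSpace ι] [TopologicalSpace X] [FirstCountableTopology X]
    [MeasurableSpace X] [OpensMeasurableSpace X] (ν : ProbabilityMeasure ι) :
    Continuous fun x : ι → X => ν.map (Measurable.of_discrete (f := x)).aemeasurable :=
  continuous_iff_continuousAt.2 fun x => tendsto_map_of_ae_tendsto ν _ _
    (.of_forall fun i => (continuous_apply i).tendsto x)

theorem isOpen_setOf_measure_lt {X : Type*} [TopologicalSpace X] [HasOuterApproxClosed X]
    [MeasurableSpace X] [OpensMeasurableSpace X] {F : Set X} (hF : IsClosed F) (c : ℝ≥0∞) :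
    IsOpen {μ : ProbabilityMeasure X | (μ : Measure X) F < c} :=
  isOpen_iff_mem_nhds.2 fun _ hμ => eventually_lt_of_limsup_lt
    ((ProbabilityMeasure.limsup_measure_closed_le_of_tendsto tendsto_id hF).trans_lt hμ)

variable {X : Type*} [TopologicalSpace X] [TopologicalSpace.PseudoMetrizableSpace X]
  [SecondCountableTopology X] [MeasurableSpace X] [OpensMeasurableSpace X]

theorem exists_fin_map_mem_of_isOpen {U : Set (ProbabilityMeasure X)}
    (hU : IsOpen U) (hU' : U.Nonempty) :
    ∃ (n : ℕ) (ν : ProbabilityMeasure (Fin n)) (x : Fin n → X),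
      ν.map (Measurable.of_discrete (f := x)).aemeasurable ∈ U := by
  let := TopologicalSpace.pseudoMetrizableSpacePseudoMetric X
  obtain ⟨μ, hμ⟩ := hU'
  have : Nonempty X := μ.nonempty
  let e := TopologicalSpace.denseSeq X
  have hlim := tendsto_map_of_ae_tendsto μ
    (fun N => (SimpleFunc.nearestPt e N).measurable.aemeasurable) aemeasurable_id
    (.of_forall fun y => SimpleFunc.tendsto_nearestPt (TopologicalSpace.denseRange_denseSeq X y))
  have map_id : μ.map aemeasurable_id = μ := Subtype.ext Measure.map_id
  obtain ⟨N, hN⟩ := (hlim.eventually (hU.mem_nhds (map_id.symm ▸ hμ))).exists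
  let ind (y : X) : Fin (N + 1) := Fin.ofNat (N + 1) (SimpleFunc.nearestPtInd e N y)
  have measurable_ind : Measurable ind :=
    (Measurable.of_discrete (f := Fin.ofNat (N + 1))).comp (SimpleFunc.nearestPtInd e N).measurable
  have eval_ind : (fun i : Fin (N + 1) => e i) ∘ ind = SimpleFunc.nearestPt e N := by
    ext y
    simp [ind, SimpleFunc.nearestPt,
      Nat.mod_eq_of_lt (Nat.lt_succ_of_le (SimpleFunc.nearestPtInd_le e N y))]
  have map_ind : (μ.map measurable_ind.aemeasurable).map
      (Measurable.of_discrete (f := fun i : Fin (N + 1) => e i)).aemeasurable =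
        μ.map (SimpleFunc.nearestPt e N).measurable.aemeasurable := by
    ext1
    rw [ProbabilityMeasure.toMeasure_map, ProbabilityMeasure.toMeasure_map,
      ProbabilityMeasure.toMeasure_map, Measure.map_map .of_discrete measurable_ind, eval_ind]
  exact ⟨N + 1, μ.map measurable_ind.aemeasurable, fun i => e i, map_ind ▸ hN⟩

theorem exists_map_mem_of_isOpen_of_singleton_le
    {U : Set (ProbabilityMeasure X)} (hU : IsOpen U) (hU' : U.Nonempty) (m : ℕ) [NeZero m] :
    ∃ (n : ℕ) (ν : ProbabilityMeasure (Fin n × Fin m)) (x : Fin n × Fin m → X),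
      (∀ p, (ν : Measure (Fin n × Fin m)) {p} ≤ (m : ℝ≥0∞)⁻¹) ∧
        ν.map (Measurable.of_discrete (f := x)).aemeasurable ∈ U := by
  obtain ⟨n, ν, x, hx⟩ := exists_fin_map_mem_of_isOpen hU hU'
  -- Each of the `n` atoms is split into `m` coinciding ones.
  let uniform : ProbabilityMeasure (Fin m) :=
    ⟨(PMF.uniformOfFintype (Fin m)).toMeasure, inferInstance⟩
  have uniform_singleton (j : Fin m) : (uniform : Measure (Fin m)) {j} = (m : ℝ≥0∞)⁻¹ := by
    simp [uniform]
  have map_fst : (ν.prod uniform).map (Measurable.of_discrete (f := x ∘ Prod.fst)).aemeasurable =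
      ν.map (Measurable.of_discrete (f := x)).aemeasurable := by
    ext1
    rw [ProbabilityMeasure.toMeasure_map, ProbabilityMeasure.toMeasure_map,
      ProbabilityMeasure.toMeasure_prod, ← Measure.map_map .of_discrete measurable_fst,
      Measure.map_fst_prod, measure_univ, one_smul]
  refine ⟨n, ν.prod uniform, x ∘ Prod.fst, fun p => ?_, map_fst ▸ hx⟩
  calc (ν.prod uniform : Measure (Fin n × Fin m)) {p}
      = (ν : Measure (Fin n)) {p.1} * (uniform : Measure (Fin m)) {p.2} := by
        rw [ProbabilityMeasure.toMeasure_prod, ← Measure.prod_prod, singleton_prod_singleton]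
    _ ≤ 1 * (m : ℝ≥0∞)⁻¹ := by
        rw [uniform_singleton]
        gcongr
        exact prob_le_one
    _ = (m : ℝ≥0∞)⁻¹ := one_mul _

theorem dense_setOf_prod_self_lt {D : Set (X × X)} (hD : IsClosed D)
    (hD' : Dense Dᶜ) {c : ℝ≥0∞} (hc : c ≠ 0) :
    Dense {μ : ProbabilityMeasure X | (μ.prod μ : Measure (X × X)) D < c} := by
  refine dense_iff_inter_open.2 fun U hU hU' => ?_
  obtain ⟨m, hm⟩ := ENNReal.exists_inv_nat_lt hc
  have : NeZero m := ⟨by rintro rfl; simp at hm⟩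
  obtain ⟨n, ν, x₀, hν, hx₀⟩ := exists_map_mem_of_isOpen_of_singleton_le hU hU' m
  obtain ⟨x, hxU, hxD⟩ := (dense_setOf_pairwise_notMem hD hD').inter_open_nonempty _
    (hU.preimage (continuous_map_of_finite ν)) ⟨x₀, hx₀⟩
  exact ⟨_, hxU, (prod_map_map_le (ν : Measure (Fin n × Fin m)) hν .of_discrete
    hD.measurableSet hxD).trans_lt hm⟩

theorem setOf_prod_self_eq_zero_mem_residual {D : Set (X × X)}
    (hD : IsClosed D) (hD' : Dense Dᶜ) :
    {μ : ProbabilityMeasure X | (μ.prod μ : Measure (X × X)) D = 0} ∈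
      residual (ProbabilityMeasure X) := by
  have continuous_prod_self : Continuous fun μ : ProbabilityMeasure X => μ.prod μ :=
    ProbabilityMeasure.continuous_prod.comp (continuous_id.prodMk continuous_id)
  have eventually_lt (n : ℕ) : ∀ᶠ μ : ProbabilityMeasure X in residual _,
      (μ.prod μ : Measure (X × X)) D < (n : ℝ≥0∞)⁻¹ :=
    residual_of_dense_open ((isOpen_setOf_measure_lt hD _).preimage continuous_prod_self)
      (dense_setOf_prod_self_lt hD hD' (by simp))
  filter_upwards [eventually_countable_forall.2 eventually_lt] with μ hμ
  by_contra hpos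
  obtain ⟨n, hn⟩ := ENNReal.exists_inv_nat_lt hpos
  exact lt_asymm hn (hμ n)

end SquareNull

theorem isOpenMap_inv_mul {G : Type*} [Group G] [TopologicalSpace G]
    [SeparatelyContinuousMul G] : IsOpenMap fun p : G × G => p.1⁻¹ * p.2 :=
  IsOpenMap.of_sections fun x =>
    ⟨fun y => (x.1, x.1 * y), by fun_prop, by simp, fun y => by simp⟩

theorem leftNullMeasures_mem_residual_of_isMeagre {G : Type*} [Group G] [TopologicalSpace G]
    [IsTopologicalGroup G] [SecondCountableTopology G] [MeasurableSpace G] [OpensMeasurableSpace G]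
    {A : Set G} (hA : IsMeagre (A⁻¹ * A)) :
    leftNullMeasures A ∈ residual (ProbabilityMeasure G) := by
  obtain ⟨S, S_open, S_dense, S_countable, hSA⟩ := mem_residual_iff.1 hA
  let D (U : Set G) : Set (G × G) := (fun p => p.1⁻¹ * p.2) ⁻¹' Uᶜ
  have eventually_null : ∀ᶠ μ : ProbabilityMeasure G in residual _,
      ∀ U ∈ S, (μ.prod μ : Measure (G × G)) (D U) = 0 :=
    (eventually_countable_ball S_countable).2 fun U hU =>
      setOf_prod_self_eq_zero_mem_residual
        ((S_open U hU).isClosed_compl.preimage (by fun_prop))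
        (by simpa [D] using (S_dense U hU).preimage isOpenMap_inv_mul)
  filter_upwards [eventually_null] with μ hμ g
  have prod_subset : (g • A) ×ˢ (g • A) ⊆ ⋃ U ∈ S, D U := by
    rintro ⟨_, _⟩ ⟨⟨a, ha, rfl⟩, ⟨b, hb, rfl⟩⟩
    have hab : a⁻¹ * b ∉ ⋂₀ S := fun h => hSA h (Set.mul_mem_mul (inv_mem_inv.2 ha) hb)
    simpa [D, mul_assoc] using hab
  have prod_null : (μ : Measure G).prod μ ((g • A) ×ˢ (g • A)) = 0 :=
    measure_mono_null prod_subset ((measure_biUnion_null_iff S_countable).2 hμ)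
  rw [Measure.prod_prod] at prod_null
  exact mul_self_eq_zero.1 prod_null

theorem universallyMeasurable_of_analyticSet {X : Type*} [TopologicalSpace X] [T2Space X]
    [MeasurableSpace X] [OpensMeasurableSpace X] {A : Set X} (hA : AnalyticSet A) :
    UniversallyMeasurable A :=
  fun μ => nullMeasurableSet_of_analyticSet hA (μ : Measure X)

theorem one_mem_interior_of_not_isGenericallyLeftHaarNull {G : Type*} [Group G]
    [TopologicalSpace G] [IsTopologicalGroup G] [T2Space G] [SecondCountableTopology G]
    [BaireSpace G] [MeasurableSpace G] [OpensMeasurableSpace G] {A : Set G} (hA : AnalyticSet A)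
    (h : ¬ IsGenericallyLeftHaarNull A) : (1 : G) ∈ interior (A⁻¹ * A * A⁻¹ * A) := by
  have not_isMeagre : ¬ IsMeagre (A⁻¹ * A) := fun hmeagre =>
    h ⟨universallyMeasurable_of_analyticSet hA,
      leftNullMeasures_mem_residual_of_isMeagre hmeagre⟩
  have baireMeasurable : BaireMeasurableSet (A⁻¹ * A) :=
    baireMeasurableSet_of_analyticSet (analyticSet_mul (analyticSet_inv hA) hA)
  simpa only [mul_inv_rev, inv_inv, mul_assoc] using
    one_mem_interior_inv_mul_of_not_isMeagre baireMeasurable not_isMeagre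

theorem IsGenericallyLeftHaarNull.isLeftHaarNull {G : Type*} [Group G] [TopologicalSpace G]
    [MeasurableSpace G] [OpensMeasurableSpace G] [BaireSpace (ProbabilityMeasure G)] {A : Set G}
    (hA : IsGenericallyLeftHaarNull A) : IsLeftHaarNull A :=
  have : Nonempty (ProbabilityMeasure G) := ⟨diracProba 1⟩
  ⟨hA.1, (dense_of_mem_residual hA.2).nonempty⟩

theorem mainTheorem2_general {G : Type*} [Group G] [TopologicalSpace G] [IsTopologicalGroup G]
    [T2Space G] [SecondCountableTopology G] [BaireSpace G] [MeasurableSpace G]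
    [OpensMeasurableSpace G] [BaireSpace (ProbabilityMeasure G)] {A : Set G} (hA : AnalyticSet A) :
    (¬ IsGenericallyLeftHaarNull A → (1 : G) ∈ interior (A⁻¹ * A * A⁻¹ * A)) ∧
      (¬ IsLeftHaarNull A →
        ¬ IsGenericallyLeftHaarNull A ∧ (1 : G) ∈ interior (A⁻¹ * A * A⁻¹ * A)) := by
  refine ⟨one_mem_interior_of_not_isGenericallyLeftHaarNull hA, fun h => ?_⟩
  have hgen : ¬ IsGenericallyLeftHaarNull A := mt IsGenericallyLeftHaarNull.isLeftHaarNull h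
  exact ⟨hgen, one_mem_interior_of_not_isGenericallyLeftHaarNull hA hgen⟩

end SteinhausPolish

theorem mainTheorem2 {G : Type*} [Group G] [TopologicalSpace G] [IsTopologicalGroup G]
    [PolishSpace G] [Uncountable G] [MeasurableSpace G] [BorelSpace G]
    (A : Set G) (hA : MeasureTheory.AnalyticSet A) :
    (¬ SteinhausPolish.IsGenericallyLeftHaarNull A →
      (1 : G) ∈ interior (A⁻¹ * A * A⁻¹ * A)) ∧
    (¬ SteinhausPolish.IsLeftHaarNull A →
      ¬ SteinhausPolish.IsGenericallyLeftHaarNull A ∧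
        (1 : G) ∈ interior (A⁻¹ * A * A⁻¹ * A)) :=
  SteinhausPolish.mainTheorem2_general hA
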